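/- Let $k$ be a field, let $m,n,a,t,r\ge 0$ be integers with $a\le n$ and $r\le t$, let $X=(x_{i,j})_{1\le i\le m,\,1\le j\le n}$ be a generic $m\times n$ matrix (its entries are independent variables), and let $R=k[x_{i,j}]$ be the polynomial ring in its entries. Regard $X$ as a block matrix $X=(A\,B)$, where $A$ has size $m\times a$ and $B$ has size $m\times(n-a)$. Let $J\subseteq R$ be the ideal generated by the $t$-minors of $X$ that involve at least $r$ columns of $A$, let $I_t(X)\subseteq R$ be the ideal generated by all $t$-minors of $X$, and let $I_r(A)\subseteq R$ be the ideal generated by all $r$-minors of $A$. (The $0$-minor is $1$, and the ideal generated by the empty set is $0$.) Then $$J = I_t(X)\cap I_r(A).$$ -/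

import Mathlib

/-- The ideal `I_t(M)` generated by the `t`-minors of `M`. A `t`-minor is the determinant of the
submatrix on `t` rows and `t` columns, each listed in increasing order (so for `t = 0` it is `1`,
and there is none if `t` exceeds the number of rows or columns). -/
def minorIdeal {R : Type*} [CommRing R] {m n : ℕ} (t : ℕ) (M : Matrix (Fin m) (Fin n) R) :
    Ideal R :=
  Ideal.span {f | ∃ (rows : Fin t ↪o Fin m) (cols : Fin t ↪o Fin n),
    f = (M.submatrix rows cols).det}

/-- The block of `M` consisting of its first `a` columns. -/
def firstColumns {R : Type*} {m n : ℕ} (a : ℕ) (ha : a ≤ n) (M : Matrix (Fin m) (Fin n) R) :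
    Matrix (Fin m) (Fin a) R :=
  M.submatrix id (Fin.castLE ha)

/-- The ideal generated by the `t`-minors of `M` that involve at least `r` of the first `a`
columns of `M`. -/
def blockMinorIdeal {R : Type*} [CommRing R] {m n : ℕ} (a t r : ℕ)
    (M : Matrix (Fin m) (Fin n) R) : Ideal R :=
  Ideal.span {f | ∃ (rows : Fin t ↪o Fin m) (cols : Fin t ↪o Fin n),
    r ≤ (Finset.univ.filter fun i : Fin t => (cols i : ℕ) < a).card ∧
    f = (M.submatrix rows cols).det}

/-! Append an identity block to X. Up to sign, every minor of X is then a maximal minor of (X | 1),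
and the number of columns it takes from X or from A can be read off its column set. Maximal minors
obey a straightening law: the exchange relations rewrite any product as a combination of standard
products, never lowering the number of columns of the first factor among the first x
(`minorProd_cons_mem_standardSpan`). Hence each element of I_t(X) is a combination of standard
products whose first factor has at least t columns in X
(`exists_mem_standardSpan_of_mem_minorIdeal`).

If that first factor also has at least r columns in A, Laplace expansion puts the product in J
(`maxMinor_augmentOne_mem_blockMinorIdeal`). The remaining standard products are linearly
independent modulo I_r(A) (`eq_zero_of_sum_minorProd_mem_minorIdeal`): a specialization that makes A
of rank less than r keeps their leading monomials, which are distinct. So an element of the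
intersection has no such remaining terms. The inclusion of J in the intersection is Laplace
expansion again. -/

/-- The alternating map obtained by fixing the arguments of `f` outside `P`. -/
def AlternatingMap.restrictArgs {R M N ι : Type*} [CommRing R] [AddCommGroup M] [Module R M]
    [AddCommGroup N] [Module R N] (f : M [⋀^ι]→ₗ[R] N) (P : ι → Prop) [DecidablePred P]
    (z : ι → M) : M [⋀^{i // P i}]→ₗ[R] N where
  toMultilinearMap := f.toMultilinearMap.domDomRestrict P fun i => z i
  map_eq_zero_of_eq' v i j hv hij :=
    f.map_eq_zero_of_eq _ (i := i) (j := j) (by simpa [i.2, j.2] using hv)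
      fun h => hij (Subtype.ext h)

theorem AlternatingMap.restrictArgs_apply {R M N ι : Type*} [CommRing R] [AddCommGroup M]
    [Module R M] [AddCommGroup N] [Module R N] (f : M [⋀^ι]→ₗ[R] N) (P : ι → Prop)
    [DecidablePred P] (z : ι → M) (v : {i // P i} → M) :
    f.restrictArgs P z v = f fun i => if h : P i then v ⟨i, h⟩ else z i := rfl

open scoped TensorProduct

/-! ### Maximal minors, exchange relations and the straightening law. -/

section MaxMinor

variable {R : Type*} [CommRing R] {m N : ℕ}

/-- The maximal minor of `M` on the columns `c`, as an alternating function of `c`. -/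
def maxMinor (M : Matrix (Fin m) (Fin N) R) (c : Fin m → Fin N) : R :=
  (M.submatrix id c).det

theorem maxMinor_eq_detRowAlternating (M : Matrix (Fin m) (Fin N) R) (c : Fin m → Fin N) :
    maxMinor M c = Matrix.detRowAlternating (fun i => M.transpose (c i)) := by
  rw [maxMinor, ← Matrix.det_transpose]
  rfl

theorem maxMinor_comp_perm (M : Matrix (Fin m) (Fin N) R) (c : Fin m → Fin N)
    (σ : Equiv.Perm (Fin m)) :
    maxMinor M (c ∘ σ) = (Equiv.Perm.sign σ : ℤ) * maxMinor M c :=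
  Matrix.det_permute' σ (M.submatrix id c)

theorem maxMinor_eq_zero_of_not_injective (M : Matrix (Fin m) (Fin N) R) {c : Fin m → Fin N}
    (hc : ¬ Function.Injective c) : maxMinor M c = 0 := by
  simp only [Function.Injective, not_forall] at hc
  obtain ⟨i, j, hij, hne⟩ := hc
  exact Matrix.det_zero_of_column_eq hne fun l => by simp [hij]

/-- The strictly increasing rearrangement of an injective tuple. -/
theorem exists_orderEmbedding_eq_comp_perm {c : Fin m → Fin N} (hc : Function.Injective c) :
    ∃ (d : Fin m ↪o Fin N) (σ : Equiv.Perm (Fin m)), ⇑d = c ∘ σ :=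
  ⟨OrderEmbedding.ofStrictMono (c ∘ Tuple.sort c)
    ((Tuple.monotone_sort c).strictMono_of_injective (hc.comp (Tuple.sort c).injective)),
    Tuple.sort c, rfl⟩

section Exchange

variable (a b : Fin m → Fin N) (j : Fin m)

/-- The entries of `a` from place `j` on and those of `b` up to place `j`. -/
def exchangePool : {i : Fin m // j ≤ i} ⊕ {i : Fin m // i ≤ j} → Fin N :=
  Sum.elim (fun i => a i) (fun i => b i)

/-- The tuple `a` with its entries from place `j` on exchanged according to `σ`. -/
def exchangeLeft (σ : Equiv.Perm ({i : Fin m // j ≤ i} ⊕ {i : Fin m // i ≤ j})) (i : Fin m) :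
    Fin N :=
  if h : j ≤ i then exchangePool a b j (σ (Sum.inl ⟨i, h⟩)) else a i

/-- The tuple `b` with its entries up to place `j` exchanged according to `σ`. -/
def exchangeRight (σ : Equiv.Perm ({i : Fin m // j ≤ i} ⊕ {i : Fin m // i ≤ j})) (i : Fin m) :
    Fin N :=
  if h : i ≤ j then exchangePool a b j (σ (Sum.inr ⟨i, h⟩)) else b i

theorem exchangeLeft_one : exchangeLeft a b j 1 = a := by
  ext i
  simp [exchangeLeft, exchangePool]

theorem exchangeRight_one : exchangeRight a b j 1 = b := by
  ext i
  simp [exchangeRight, exchangePool]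

/-- The quadratic relation between maximal minors that exchanges `m + 1` columns. -/
theorem exists_exchange_relation [IsDomain R] (M : Matrix (Fin m) (Fin N) R) :
    ∃ s : Finset (Equiv.Perm ({i : Fin m // j ≤ i} ⊕ {i : Fin m // i ≤ j})),
      (∀ σ ∈ s, ∃ i, ∃ i', σ (Sum.inl i) = Sum.inr i') ∧
      maxMinor M a * maxMinor M b =
        -∑ σ ∈ s, ((Equiv.Perm.sign σ : ℤ) : R) *
          (maxMinor M (exchangeLeft a b j σ) * maxMinor M (exchangeRight a b j σ)) := by
  classical
  let D : (Fin m → R) [⋀^Fin m]→ₗ[R] R := Matrix.detRowAlternating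
  let F := D.restrictArgs (fun i => j ≤ i) (fun i => M.transpose (a i))
  let G := D.restrictArgs (fun i => i ≤ j) (fun i => M.transpose (b i))
  let V := fun w => M.transpose (exchangePool a b j w)
  have hzero : F.domCoprod G V = 0 := by
    -- The pool has (m - j) + (j + 1) = m + 1 columns, one too many to be independent in a space of
    -- rank m.
    apply AlternatingMap.map_linearDependent
    intro hV
    have hcard := hV.fintype_card_le_finrank
    have h1 : Fintype.card {i : Fin m // j ≤ i} = m - j := by
      rw [Fintype.card_subtype, Finset.filter_le_eq_Ici, Fin.card_Ici]
    have h2 : Fintype.card {i : Fin m // i ≤ j} = j + 1 := by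
      rw [Fintype.card_subtype, Finset.filter_ge_eq_Iic, Fin.card_Iic]
    rw [Fintype.card_sum, h1, h2, Module.finrank_fintype_fun_eq_card, Fintype.card_fin] at hcard
    omega
  have hterm : ∀ σ : Equiv.Perm ({i : Fin m // j ≤ i} ⊕ {i : Fin m // i ≤ j}),
      LinearMap.mul' R R (AlternatingMap.domCoprod.summand F G (Quotient.mk'' σ) V) =
        ((Equiv.Perm.sign σ : ℤ) : R) *
          (maxMinor M (exchangeLeft a b j σ) * maxMinor M (exchangeRight a b j σ)) := by
    intro σ
    have hF : F (fun i => V (σ (Sum.inl i))) = maxMinor M (exchangeLeft a b j σ) := by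
      rw [maxMinor_eq_detRowAlternating, AlternatingMap.restrictArgs_apply]
      congr 1
      ext i l
      by_cases h : j ≤ i <;> simp [exchangeLeft, V, h]
    have hG : G (fun i => V (σ (Sum.inr i))) = maxMinor M (exchangeRight a b j σ) := by
      rw [maxMinor_eq_detRowAlternating, AlternatingMap.restrictArgs_apply]
      congr 1
      ext i l
      by_cases h : i ≤ j <;> simp [exchangeRight, V, h]
    have hV : AlternatingMap.domCoprod.summand F G (Quotient.mk'' σ) V =
        Equiv.Perm.sign σ • (F (fun i => V (σ (Sum.inl i))) ⊗ₜ[R] G fun i => V (σ (Sum.inr i))) :=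
      rfl
    rw [hV, hF, hG, Units.smul_def, map_zsmul, LinearMap.mul'_apply, zsmul_eq_mul]
  let q₁ : Equiv.Perm.ModSumCongr {i : Fin m // j ≤ i} {i : Fin m // i ≤ j} :=
    Quotient.mk'' 1
  have hsum : ∑ q, LinearMap.mul' R R (AlternatingMap.domCoprod.summand F G q V) = 0 := by
    rw [← map_sum, ← map_zero (LinearMap.mul' R R), ← hzero, AlternatingMap.domCoprod_apply,
      sum_apply]
  rw [← Finset.add_sum_erase _ _ (Finset.mem_univ q₁), hterm, exchangeLeft_one,
    exchangeRight_one] at hsum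
  -- The coset of the identity gives the original product. A representative of any other coset does
  -- not preserve the two sides, so it brings some column of `b` into `a`.
  refine ⟨(Finset.univ.erase q₁).image Quotient.out, ?_, ?_⟩
  · intro σ hσ
    obtain ⟨q, hq, rfl⟩ := Finset.mem_image.1 hσ
    by_contra! hcon
    apply (Finset.mem_erase.1 hq).1
    have hmem : q.out ∈ (Equiv.Perm.sumCongrHom {i : Fin m // j ≤ i} {i : Fin m // i ≤ j}).range := by
      apply Equiv.Perm.mem_sumCongrHom_range_of_perm_mapsTo_inl
      rintro _ ⟨i, rfl⟩
      cases h : q.out (Sum.inl i) with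
      | inl i' => exact ⟨i', rfl⟩
      | inr i' => exact absurd h (hcon i i')
    rw [← Quotient.out_eq' q]
    exact Quotient.sound' (QuotientGroup.leftRel_apply.2 (by simpa using hmem))
  · rw [Finset.sum_image (fun q _ q' _ h => Quotient.out_injective h)]
    rw [eq_neg_iff_add_eq_zero, ← hsum]
    congr 1
    · simp
    · refine Finset.sum_congr rfl fun q _ => ?_
      rw [← hterm, Quotient.out_eq']

/-- The pool entries from `a` are at least `a j`, those from `b` at most `b j < a j`, so the left
places initially hold the largest entries. After subtracting `g (a j)`, the initial left sum is the
sum of positive parts over the whole pool, which no permutation changes and which bounds every left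
sum. Weakly monotone `g` serve to count columns below a bound, strictly monotone ones to make
straightening terminate. -/
theorem sum_exchangeLeft_le (ha : StrictMono a) (hb : StrictMono b) (hj : b j < a j)
    (σ : Equiv.Perm ({i : Fin m // j ≤ i} ⊕ {i : Fin m // i ≤ j})) {g : Fin N → ℤ}
    (hg : Monotone g) :
    ∑ i, g (exchangeLeft a b j σ i) ≤ ∑ i, g (a i) ∧
      (StrictMono g → (∃ i, ∃ i', σ (Sum.inl i) = Sum.inr i') →
        ∑ i, g (exchangeLeft a b j σ i) < ∑ i, g (a i)) := by
  classical
  let z := exchangePool a b j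
  let y : _ → ℤ := fun w => g (z w) - g (a j)
  have hyl : ∀ i, 0 ≤ y (Sum.inl i) := fun i => sub_nonneg.2 (hg (ha.monotone i.2))
  have hyr : ∀ i, y (Sum.inr i) ≤ 0 := fun i =>
    sub_nonpos.2 (hg ((hb.monotone i.2).trans hj.le))
  have hsplit : ∀ f : Fin m → ℤ, ∑ i, f i = ∑ i : {i // j ≤ i}, f i + ∑ i : {i // ¬ j ≤ i}, f i :=
    fun f => (Fintype.sum_subtype_add_sum_subtype (fun i => j ≤ i) f).symm
  have hL : ∑ i, g (exchangeLeft a b j σ i) - ∑ i, g (a i) =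
      ∑ i, y (σ (Sum.inl i)) - ∑ i, y (Sum.inl i) := by
    rw [hsplit, hsplit (fun i => g (a i))]
    have h1 : ∑ i : {i // j ≤ i}, g (exchangeLeft a b j σ i) =
        ∑ i, g (z (σ (Sum.inl i))) := by
      refine Finset.sum_congr rfl fun i _ => ?_
      simp [exchangeLeft, i.2, z]
    have h2 : ∑ i : {i // ¬ j ≤ i}, g (exchangeLeft a b j σ i) =
        ∑ i : {i // ¬ j ≤ i}, g (a i) := by
      refine Finset.sum_congr rfl fun i _ => ?_
      simp [exchangeLeft, i.2]
    rw [h1, h2]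
    simp only [y, Finset.sum_sub_distrib]
    simp [z, exchangePool]
  have hmax : ∑ i, max (y (σ (Sum.inl i))) 0 ≤ ∑ i, y (Sum.inl i) := by
    calc ∑ i, max (y (σ (Sum.inl i))) 0
        ≤ ∑ i, max (y (σ (Sum.inl i))) 0 + ∑ i, max (y (σ (Sum.inr i))) 0 :=
          le_add_of_nonneg_right (Finset.sum_nonneg fun i _ => le_max_right _ _)
      _ = ∑ w, max (y (σ w)) 0 :=
          (Fintype.sum_sum_type fun w => max (y (σ w)) 0).symm
      _ = ∑ w, max (y w) 0 := Equiv.sum_comp σ fun w => max (y w) 0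
      _ = ∑ i, y (Sum.inl i) := by
          rw [Fintype.sum_sum_type]
          simp [max_eq_left (hyl _), max_eq_right (hyr _)]
  constructor
  · have := Finset.sum_le_sum fun i (_ : i ∈ Finset.univ) => le_max_left (y (σ (Sum.inl i))) 0
    linarith
  · rintro hs ⟨i, i', hi⟩
    have : ∑ i, y (σ (Sum.inl i)) < ∑ i, max (y (σ (Sum.inl i))) 0 := by
      refine Finset.sum_lt_sum (fun i _ => le_max_left _ _) ⟨i, Finset.mem_univ _, ?_⟩
      rw [hi]
      exact lt_max_of_lt_right (sub_neg.2 (hs ((hb.monotone i'.2).trans_lt hj)))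
    linarith

end Exchange

/-- If `a ≤ b` fails then the product of the minors on `a` and `b` is a combination of products
whose first factor sits on smaller columns. -/
theorem maxMinor_mul_mem_span [IsDomain R] {k : Type*} [CommRing k] [Algebra k R]
    (M : Matrix (Fin m) (Fin N) R) (a b : Fin m ↪o Fin N) (hab : ¬ ∀ i, a i ≤ b i) :
    maxMinor M a * maxMinor M b ∈ Submodule.span k
      {f | ∃ a' b' : Fin m ↪o Fin N, f = maxMinor M a' * maxMinor M b' ∧
        (∀ g : Fin N → ℤ, Monotone g → ∑ i, g (a' i) ≤ ∑ i, g (a i)) ∧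
        (∀ g : Fin N → ℤ, StrictMono g → ∑ i, g (a' i) < ∑ i, g (a i))} := by
  push Not at hab
  obtain ⟨j, hj⟩ := hab
  obtain ⟨s, hs, heq⟩ := exists_exchange_relation a b j M
  rw [heq]
  refine Submodule.neg_mem _ (Submodule.sum_mem _ fun σ hσ => ?_)
  rw [← zsmul_eq_mul]
  refine zsmul_mem ?_ _
  by_cases h1 : Function.Injective (exchangeLeft a b j σ)
  swap
  · rw [maxMinor_eq_zero_of_not_injective M h1, zero_mul]
    exact zero_mem _
  by_cases h2 : Function.Injective (exchangeRight a b j σ)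
  swap
  · rw [maxMinor_eq_zero_of_not_injective M h2, mul_zero]
    exact zero_mem _
  obtain ⟨a', τ, ha'⟩ := exists_orderEmbedding_eq_comp_perm h1
  obtain ⟨b', υ, hb'⟩ := exists_orderEmbedding_eq_comp_perm h2
  have hsum : ∀ g : Fin N → ℤ, ∑ i, g (a' i) = ∑ i, g (exchangeLeft a b j σ i) := by
    intro g
    rw [ha']
    exact Equiv.sum_comp τ fun i => g (exchangeLeft a b j σ i)
  have hmem := Submodule.subset_span (R := k) (s := {f | ∃ a' b' : Fin m ↪o Fin N,
      f = maxMinor M a' * maxMinor M b' ∧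
        (∀ g : Fin N → ℤ, Monotone g → ∑ i, g (a' i) ≤ ∑ i, g (a i)) ∧
        (∀ g : Fin N → ℤ, StrictMono g → ∑ i, g (a' i) < ∑ i, g (a i))})
    ⟨a', b', rfl,
      fun g hg => (hsum g).trans_le (sum_exchangeLeft_le a b j a.strictMono b.strictMono hj σ hg).1,
      fun g hg => (hsum g).trans_lt
        ((sum_exchangeLeft_le a b j a.strictMono b.strictMono hj σ hg.monotone).2 hg (hs σ hσ))⟩
  rw [ha', hb', maxMinor_comp_perm, maxMinor_comp_perm] at hmem
  obtain h | h := Int.units_eq_one_or (Equiv.Perm.sign τ) <;>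
  obtain h' | h' := Int.units_eq_one_or (Equiv.Perm.sign υ) <;>
  simpa [h, h'] using hmem

/-- Lists of column choices that increase weakly, componentwise. -/
def IsStandard (l : List (Fin m ↪o Fin N)) : Prop :=
  l.Pairwise fun c d => ∀ i, c i ≤ d i

/-- The number of entries of `c` that are smaller than `x`. -/
def countBelow (x : ℕ) (c : Fin m → Fin N) : ℕ :=
  (Finset.univ.filter fun i => (c i : ℕ) < x).card

/-- Minus the indicator of the values below `x` is a monotone test function. -/
theorem countBelow_le_of_forall_sum_le (x : ℕ) {c d : Fin m → Fin N}
    (h : ∀ g : Fin N → ℤ, Monotone g → ∑ i, g (d i) ≤ ∑ i, g (c i)) :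
    countBelow x c ≤ countBelow x d := by
  have key : ∀ e : Fin m → Fin N,
      ∑ i, (fun v : Fin N => if (v : ℕ) < x then (-1 : ℤ) else 0) (e i) = -(countBelow x e : ℤ) := by
    intro e
    rw [← Finset.sum_filter, Finset.sum_const, countBelow]
    simp
  have := h (fun v => if (v : ℕ) < x then (-1 : ℤ) else 0) (by
    intro v w hvw
    have : (v : ℕ) ≤ w := hvw
    dsimp only
    split_ifs <;> omega)
  rw [key, key] at this
  omega

/-- The product of the minors listed in `l`. -/
def minorProd (M : Matrix (Fin m) (Fin N) R) (l : List (Fin m ↪o Fin N)) : R :=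
  (l.map fun c => maxMinor M c).prod

theorem minorProd_cons (M : Matrix (Fin m) (Fin N) R) (c : Fin m ↪o Fin N)
    (l : List (Fin m ↪o Fin N)) : minorProd M (c :: l) = maxMinor M c * minorProd M l := by
  simp [minorProd]

theorem minorProd_append (M : Matrix (Fin m) (Fin N) R) (l l' : List (Fin m ↪o Fin N)) :
    minorProd M (l ++ l') = minorProd M l * minorProd M l' := by
  simp [minorProd]

/-- The span of the standard products of `K + 1` maximal minors whose first factor has at least `t`
columns among the first `x`. -/
def standardSpan (k : Type*) [CommRing k] [Algebra k R] (M : Matrix (Fin m) (Fin N) R)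
    (x t K : ℕ) : Submodule k R :=
  Submodule.span k {f | ∃ (c : Fin m ↪o Fin N) (l : List (Fin m ↪o Fin N)),
    IsStandard (c :: l) ∧ l.length = K ∧ t ≤ countBelow x c ∧ f = minorProd M (c :: l)}

theorem standardSpan_mono (k : Type*) [CommRing k] [Algebra k R] (M : Matrix (Fin m) (Fin N) R)
    (x : ℕ) {t t' : ℕ} (h : t ≤ t') (K : ℕ) : standardSpan k M x t' K ≤ standardSpan k M x t K := by
  refine Submodule.span_mono ?_
  rintro f ⟨c, l, hl, hK, ht, rfl⟩
  exact ⟨c, l, hl, hK, h.trans ht, rfl⟩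

/-- The straightening law. -/
theorem minorProd_cons_mem_standardSpan [IsDomain R] (k : Type*) [CommRing k] [Algebra k R]
    (M : Matrix (Fin m) (Fin N) R) (x : ℕ) (l : List (Fin m ↪o Fin N)) (c : Fin m ↪o Fin N) :
    minorProd M (c :: l) ∈ standardSpan k M x (countBelow x c) l.length := by
  induction hn : l.length generalizing l c with
  | zero =>
    obtain rfl := List.length_eq_zero_iff.1 hn
    exact Submodule.subset_span ⟨c, [], by simp [IsStandard], rfl, le_rfl, rfl⟩
  | succ K ih =>
    -- Inner induction on the column sum of the first factor. If `c ≤ d` fails, an exchange replaces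
    -- `c` by some `c'` of smaller sum. Nothing need be known about the new second factor `d'`,
    -- since the outer induction on length restraightens `d' :: l`.
    have main : ∀ (w : ℕ) (c : Fin m ↪o Fin N), ∑ i, (c i : ℕ) = w →
        ∀ q ∈ standardSpan k M x 0 K,
          maxMinor M c * q ∈ standardSpan k M x (countBelow x c) (K + 1) := by
      intro w
      induction w using Nat.strong_induction_on with
      | _ w ihw =>
        intro c hc q hq
        refine Submodule.span_induction ?_ ?_ ?_ ?_ hq
        · rintro _ ⟨d, l, hl, hK, -, rfl⟩
          by_cases hcd : ∀ i, c i ≤ d i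
          · rw [← minorProd_cons]
            refine Submodule.subset_span ⟨c, d :: l, ?_, by simp [hK], le_rfl, rfl⟩
            refine List.pairwise_cons.2 ⟨fun e he => ?_, hl⟩
            obtain rfl | he := List.mem_cons.1 he
            · exact hcd
            · exact fun i => (hcd i).trans ((List.pairwise_cons.1 hl).1 e he i)
          · rw [minorProd_cons, ← mul_assoc]
            refine Submodule.span_induction
              (p := fun f _ => f * minorProd M l ∈
                standardSpan k M x (countBelow x c) (K + 1)) ?_ ?_ ?_ ?_
              (maxMinor_mul_mem_span (k := k) M c d hcd)
            · rintro _ ⟨c', d', rfl, hle, hlt⟩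
              rw [mul_assoc, ← minorProd_cons]
              refine standardSpan_mono k M x (countBelow_le_of_forall_sum_le x hle) _
                (ihw _ ?_ c' rfl _ ?_)
              · have := hlt (fun v => ((v : ℕ) : ℤ)) fun v w h => by
                  simpa using h
                rw [← hc]
                exact_mod_cast this
              · exact standardSpan_mono k M x (Nat.zero_le _) _ (ih l d' hK)
            · rw [zero_mul]
              exact zero_mem _
            · intro f g _ _ hf hg
              rw [add_mul]
              exact add_mem hf hg
            · intro r f _ hf
              rw [smul_mul_assoc]
              exact Submodule.smul_mem _ _ hf
        · rw [mul_zero]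
          exact zero_mem _
        · intro f g _ _ hf hg
          rw [mul_add]
          exact add_mem hf hg
        · intro r f _ hf
          rw [mul_smul_comm]
          exact Submodule.smul_mem _ _ hf
    obtain ⟨d₀, l₀, rfl⟩ := List.exists_cons_of_length_eq_add_one hn
    rw [minorProd_cons]
    exact main _ c rfl _ (standardSpan_mono k M x (Nat.zero_le _) _ (ih l₀ d₀ (by simpa using hn)))

end MaxMinor

/-! ### Laplace expansion and minors of X as maximal minors of (X | 1). -/

section Laplace

variable {R : Type*} [CommRing R]

/-- A determinant lies in the ideal of the minors on its first `r` columns. -/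
theorem det_mem_span_minors_firstColumns {r t : ℕ} (h : r ≤ t) (M : Matrix (Fin t) (Fin t) R) :
    M.det ∈ Ideal.span {f | ∃ rows : Fin r ↪o Fin t,
      f = (M.submatrix rows (Fin.castLE h)).det} := by
  induction t, h using Nat.le_induction with
  | base => exact Ideal.subset_span ⟨RelEmbedding.refl _, rfl⟩
  | succ t h ih =>
    rw [Matrix.det_succ_column M (Fin.last t)]
    refine Ideal.sum_mem _ fun i _ => Ideal.mul_mem_left _ _ ?_
    refine Ideal.span_mono ?_ (ih (M.submatrix i.succAbove (Fin.last t).succAbove))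
    rintro f ⟨rows, rfl⟩
    refine ⟨rows.trans (Fin.succAboveOrderEmb i), ?_⟩
    rw [Matrix.submatrix_submatrix, Fin.succAbove_last]
    rfl

/-- As `c` is increasing, its entries below `x` occupy an initial segment of places. -/
theorem lt_countBelow_iff {m N x : ℕ} (c : Fin m ↪o Fin N) (i : Fin m) :
    (i : ℕ) < countBelow x c ↔ (c i : ℕ) < x :=
  Tuple.lt_card_lt_iff_apply_lt_of_monotone (f := fun i => ((c i : Fin N) : ℕ))
    fun _ _ h => c.monotone h

theorem countBelow_le {m N : ℕ} (x : ℕ) (c : Fin m → Fin N) : countBelow x c ≤ m :=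
  (Finset.card_le_univ _).trans_eq (Fintype.card_fin m)

theorem le_countBelow_of_forall {s m N x : ℕ} (hs : s ≤ m) (c : Fin m ↪o Fin N)
    (h : ∀ i : Fin m, (i : ℕ) < s → (c i : ℕ) < x) : s ≤ countBelow x c := by
  by_contra! hlt
  exact lt_irrefl _ ((lt_countBelow_iff c ⟨countBelow x c, by omega⟩).2 (h _ hlt))

variable {m n : ℕ}

theorem blockMinorIdeal_le_minorIdeal (a t r : ℕ) (X : Matrix (Fin m) (Fin n) R) :
    blockMinorIdeal a t r X ≤ minorIdeal t X := by
  refine Ideal.span_mono ?_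
  rintro f ⟨rows, cols, -, rfl⟩
  exact ⟨rows, cols, rfl⟩

theorem blockMinorIdeal_le_minorIdeal_firstColumns {a t r : ℕ} (ha : a ≤ n)
    (hrt : r ≤ t) (X : Matrix (Fin m) (Fin n) R) :
    blockMinorIdeal a t r X ≤ minorIdeal r (firstColumns a ha X) := by
  refine Ideal.span_le.2 ?_
  rintro f ⟨rows, cols, hr, rfl⟩
  refine Ideal.span_mono ?_ (det_mem_span_minors_firstColumns hrt (X.submatrix rows cols))
  rintro f ⟨rows', rfl⟩
  have hlt : ∀ i : Fin r, (cols (Fin.castLE hrt i) : ℕ) < a := fun i =>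
    (lt_countBelow_iff cols _).1 (lt_of_lt_of_le i.2 hr)
  refine ⟨rows'.trans rows, OrderEmbedding.ofStrictMono
    (fun i => ⟨cols (Fin.castLE hrt i), hlt i⟩) fun i j hij => ?_, rfl⟩
  exact cols.strictMono (show Fin.castLE hrt i < Fin.castLE hrt j from hij)

/-- The matrix `X` with an identity block added to its right. -/
def augmentOne (X : Matrix (Fin m) (Fin n) R) : Matrix (Fin m) (Fin (n + m)) R :=
  Matrix.of fun i => Fin.append (X i) ((1 : Matrix (Fin m) (Fin m) R) i)

theorem augmentOne_castAdd (X : Matrix (Fin m) (Fin n) R) (i : Fin m) (j : Fin n) :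
    augmentOne X i (Fin.castAdd m j) = X i j := by
  simp [augmentOne]

theorem augmentOne_natAdd (X : Matrix (Fin m) (Fin n) R) (i j : Fin m) :
    augmentOne X i (Fin.natAdd n j) = (1 : Matrix (Fin m) (Fin m) R) i j := by
  simp [augmentOne]

theorem augmentOne_of_lt (X : Matrix (Fin m) (Fin n) R) (i : Fin m) (j : Fin (n + m))
    (h : (j : ℕ) < n) : augmentOne X i j = X i ⟨j, h⟩ :=
  augmentOne_castAdd X i ⟨j, h⟩

theorem maxMinor_augmentOne_natAdd (X : Matrix (Fin m) (Fin n) R) :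
    maxMinor (augmentOne X) (Fin.natAddOrderEmb n) = 1 := by
  rw [maxMinor]
  convert Matrix.det_one (n := Fin m) (R := R)
  ext i j
  exact augmentOne_natAdd X i j

/-- The first `t` columns of `c` lie in X, and the first `r` of these lie in A, so Laplace expansion
along them only produces generators of J. -/
theorem maxMinor_augmentOne_mem_blockMinorIdeal {a t r : ℕ} (hrt : r ≤ t)
    (X : Matrix (Fin m) (Fin n) R) (c : Fin m ↪o Fin (n + m)) (ht : t ≤ countBelow n c)
    (hr : r ≤ countBelow a c) : maxMinor (augmentOne X) c ∈ blockMinorIdeal a t r X := by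
  have htm : t ≤ m := ht.trans (countBelow_le n c)
  refine Ideal.span_mono ?_
    (det_mem_span_minors_firstColumns htm ((augmentOne X).submatrix id c))
  rintro f ⟨rows, rfl⟩
  have hlt : ∀ i : Fin t, (c (Fin.castLE htm i) : ℕ) < n := fun i =>
    (lt_countBelow_iff c _).1 (lt_of_lt_of_le i.2 ht)
  let cols : Fin t ↪o Fin n := OrderEmbedding.ofStrictMono
    (fun i => ⟨c (Fin.castLE htm i), hlt i⟩)
    fun i j hij => c.strictMono (show Fin.castLE htm i < Fin.castLE htm j from hij)
  refine ⟨rows, cols, ?_, ?_⟩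
  · exact le_countBelow_of_forall hrt cols fun i hi =>
      (lt_countBelow_iff c (Fin.castLE htm i)).1 (lt_of_lt_of_le hi hr)
  · congr 1
    ext i j
    exact augmentOne_of_lt X _ _ (hlt j)

/-- Every minor of `X` is, up to sign, a maximal minor of `X` augmented by an identity block. -/
theorem exists_maxMinor_augmentOne_eq {t : ℕ} (X : Matrix (Fin m) (Fin n) R)
    (rows : Fin t ↪o Fin m) (cols : Fin t ↪o Fin n) :
    ∃ c : Fin m ↪o Fin (n + m), t ≤ countBelow n c ∧ ∃ u : ℤˣ,
      (X.submatrix rows cols).det = ((u : ℤ) : R) * maxMinor (augmentOne X) c := by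
  classical
  let e : Fin t ⊕ {i // i ∉ Set.range rows} ≃ Fin m :=
    ((Equiv.ofInjective rows rows.injective).sumCongr (Equiv.refl _)).trans
      (Equiv.sumCompl fun i => i ∈ Set.range rows)
  have hel : ∀ i, e (Sum.inl i) = rows i := fun i => rfl
  have her : ∀ i, e (Sum.inr i) = i := fun i => rfl
  -- Beside the chosen columns stand the identity columns of the unchosen rows. With the chosen rows
  -- listed first, the matrix is block triangular with diagonal blocks the given submatrix and 1.
  let c' : Fin t ⊕ {i // i ∉ Set.range rows} → Fin (n + m) :=
    Sum.elim (fun i => Fin.castAdd m (cols i)) fun i => Fin.natAdd n i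
  have hc' : Function.Injective c' := by
    refine Function.Injective.sumElim ?_ ?_ ?_
    · exact (Fin.castAdd_injective n m).comp cols.injective
    · exact (Fin.natAdd_injective m n).comp Subtype.val_injective
    · intro i j h
      have := congrArg Fin.val h
      simp at this
      omega
  obtain ⟨c, σ, hc⟩ := exists_orderEmbedding_eq_comp_perm (hc'.comp e.symm.injective)
  refine ⟨c, ?_, Equiv.Perm.sign σ, ?_⟩
  · have : (Finset.univ.image fun i => σ.symm (rows i)) ⊆
        Finset.univ.filter fun i => (c i : ℕ) < n := by
      intro j hj
      obtain ⟨i, -, rfl⟩ := Finset.mem_image.1 hj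
      refine Finset.mem_filter.2 ⟨Finset.mem_univ _, ?_⟩
      rw [hc]
      simp [← hel, c']
    have hcard := Finset.card_le_card this
    rwa [Finset.card_image_of_injective (f := fun i => σ.symm (rows i)) _
      (σ.symm.injective.comp rows.injective), Finset.card_univ, Fintype.card_fin] at hcard
  · have hdet : maxMinor (augmentOne X) (c' ∘ e.symm) = (X.submatrix rows cols).det := by
      have hce : (c' ∘ e.symm) ∘ e = c' := by
        ext i
        simp
      rw [maxMinor, ← Matrix.det_submatrix_equiv_self e, Matrix.submatrix_submatrix, hce]
      have hblock : (augmentOne X).submatrix (id ∘ e) c' =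
          Matrix.fromBlocks (X.submatrix rows cols) 0
            (X.submatrix (fun i : {i // i ∉ Set.range rows} => (i : Fin m)) cols) 1 := by
        ext i j
        rcases i with i | i <;> rcases j with j | j
        · simp [c', hel, augmentOne_castAdd]
        · simp only [Matrix.submatrix_apply, Function.comp_apply, c', hel,
            Sum.elim_inr, augmentOne_natAdd, id, Matrix.fromBlocks_apply₁₂, Matrix.zero_apply]
          exact Matrix.one_apply_ne fun h => j.2 ⟨i, h⟩
        · simp [c', her, augmentOne_castAdd]
        · simp [c', her, augmentOne_natAdd, Matrix.one_apply, Subtype.ext_iff]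
      rw [hblock, Matrix.det_fromBlocks_zero₁₂, Matrix.det_one, mul_one]
    rw [hc, maxMinor_comp_perm, hdet, ← mul_assoc, ← Int.cast_mul, ← Units.val_mul]
    simp

end Laplace

/-! ### Standard products span I_t(X). -/

section Spanning

variable {k : Type*} [Field k] {m n : ℕ}

local notation "Xg" => Matrix.mvPolynomialX (Fin m) (Fin n) k

/-- The new factor is appended at the end, so straightening starts from the same first factor and
keeps its column count. -/
theorem standardSpan_mul_maxMinor_le {R : Type*} [CommRing R] [IsDomain R] [Algebra k R] {N : ℕ}
    (M : Matrix (Fin m) (Fin N) R) (x t K : ℕ) (d : Fin m ↪o Fin N) {f : R}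
    (hf : f ∈ standardSpan k M x t K) : f * maxMinor M d ∈ standardSpan k M x t (K + 1) := by
  refine Submodule.span_induction ?_ ?_ ?_ ?_ hf
  · rintro _ ⟨c, l, -, rfl, ht, rfl⟩
    have := minorProd_cons_mem_standardSpan k M x (l ++ [d]) c
    rw [← List.cons_append, minorProd_append, List.length_append] at this
    simpa [minorProd] using standardSpan_mono k M x ht _ this
  · rw [zero_mul]
    exact zero_mem _
  · intro f g _ _ hf hg
    rw [add_mul]
    exact add_mem hf hg
  · intro r f _ hf
    rw [smul_mul_assoc]
    exact Submodule.smul_mem _ _ hf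

/-- The identity block is a maximal minor equal to 1, so multiplying by it lengthens products
without changing values. This brings summands to a common length. -/
theorem standardSpan_augmentOne_mono {R : Type*} [CommRing R] [IsDomain R] [Algebra k R]
    (X : Matrix (Fin m) (Fin n) R) (x t : ℕ) :
    Monotone (standardSpan k (augmentOne X) x t) := by
  refine monotone_nat_of_le_succ fun K f hf => ?_
  simpa [maxMinor_augmentOne_natAdd] using
    standardSpan_mul_maxMinor_le (augmentOne X) x t K (Fin.natAddOrderEmb n) hf

theorem zsmul_unit_mem {R : Type*} [CommRing R] [Algebra k R] (V : Submodule k R) (u : ℤ) {f : R}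
    (hf : f ∈ V) : (u : R) * f ∈ V := by
  rw [← zsmul_eq_mul]
  exact zsmul_mem hf u

/-- Every element of `I_t(X)` is a combination of standard products whose first factor has at least
`t` columns in `X`. -/
theorem exists_mem_standardSpan_of_mem_minorIdeal {t : ℕ} {f : MvPolynomial (Fin m × Fin n) k}
    (hf : f ∈ minorIdeal t Xg) : ∃ K, f ∈ standardSpan k (augmentOne Xg) n t K := by
  refine Submodule.span_induction ?_ ?_ ?_ ?_ hf
  · rintro _ ⟨rows, cols, rfl⟩
    obtain ⟨c, hc, u, hu⟩ := exists_maxMinor_augmentOne_eq Xg rows cols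
    refine ⟨0, ?_⟩
    rw [hu]
    refine zsmul_unit_mem _ _ (Submodule.subset_span ⟨c, [], ?_, rfl, hc, ?_⟩)
    · simp [IsStandard]
    · simp [minorProd]
  · exact ⟨0, zero_mem _⟩
  · rintro f g _ _ ⟨K, hK⟩ ⟨L, hL⟩
    exact ⟨max K L, add_mem (standardSpan_augmentOne_mono _ _ _ (le_max_left K L) hK)
      (standardSpan_augmentOne_mono _ _ _ (le_max_right K L) hL)⟩
  · rintro p f _ ⟨K, hK⟩
    rw [smul_eq_mul]
    induction p using MvPolynomial.induction_on with
    | C r =>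
      refine ⟨K, ?_⟩
      rw [← MvPolynomial.smul_eq_C_mul]
      exact Submodule.smul_mem _ _ hK
    | add p q hp hq =>
      obtain ⟨L₁, h₁⟩ := hp
      obtain ⟨L₂, h₂⟩ := hq
      refine ⟨max L₁ L₂, ?_⟩
      rw [add_mul]
      exact add_mem (standardSpan_augmentOne_mono _ _ _ (le_max_left L₁ L₂) h₁)
        (standardSpan_augmentOne_mono _ _ _ (le_max_right L₁ L₂) h₂)
    | mul_X p ij hp =>
      obtain ⟨L, hL⟩ := hp
      refine ⟨L + 1, ?_⟩
      obtain ⟨d, -, u, hu⟩ := exists_maxMinor_augmentOne_eq (t := 1) Xg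
        (OrderEmbedding.ofStrictMono (fun _ => ij.1) (Subsingleton.strictMono _))
        (OrderEmbedding.ofStrictMono (fun _ => ij.2) (Subsingleton.strictMono _))
      have hX : (MvPolynomial.X ij : MvPolynomial (Fin m × Fin n) k) =
          ((u : ℤ) : MvPolynomial (Fin m × Fin n) k) * maxMinor (augmentOne Xg) d := by
        rw [← hu, Matrix.det_fin_one]
        simp
      have := zsmul_unit_mem _ u (standardSpan_mul_maxMinor_le _ _ _ _ d hL)
      convert this using 1
      rw [hX]
      ring

end Spanning

/-! ### Leading monomials and independence of standard products. -/

section LeadingTerm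

open MonomialOrder

variable {m N : ℕ}

/-- The exponent of the diagonal monomial of the maximal minor on the columns `c`. -/
noncomputable def diagExponent (c : Fin m → Fin N) : Fin m ×ₗ Fin N →₀ ℕ :=
  ∑ i, Finsupp.single (toLex (i, c i)) 1

theorem sum_single_apply (σ : Equiv.Perm (Fin m)) (c : Fin m → Fin N) (i : Fin m) (j : Fin N) :
    (∑ l, Finsupp.single (toLex (σ l, c l)) 1 : Fin m ×ₗ Fin N →₀ ℕ) (toLex (i, j)) =
      if c (σ.symm i) = j then 1 else 0 := by
  rw [Finsupp.finsetSum_apply, Finset.sum_eq_single (σ.symm i)]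
  · simp [Finsupp.single_apply]
  · intro l _ hl
    rw [Finsupp.single_apply, if_neg]
    intro h
    apply hl
    exact (Equiv.eq_symm_apply σ).2 (congrArg (fun p => (ofLex p).1) h)
  · simp

theorem diagExponent_apply (c : Fin m → Fin N) (i : Fin m) (j : Fin N) :
    diagExponent c (toLex (i, j)) = if c i = j then 1 else 0 :=
  sum_single_apply 1 c i j

/-- Off-diagonal monomials of a minor are lexicographically smaller than the diagonal one. -/
theorem sum_single_lt_diagExponent {c : Fin m → Fin N} (hc : StrictMono c)
    {σ : Equiv.Perm (Fin m)} (hσ : σ ≠ 1) :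
    toLex (∑ i, Finsupp.single (toLex (σ i, c i)) 1 : Fin m ×ₗ Fin N →₀ ℕ) <
      toLex (diagExponent c) := by
  have hne : (Finset.univ.filter fun i => σ.symm i ≠ i).Nonempty := by
    by_contra hcon
    rw [Finset.not_nonempty_iff_eq_empty, Finset.filter_eq_empty_iff] at hcon
    refine hσ (Equiv.ext fun i => ?_)
    have := not_not.1 (hcon (Finset.mem_univ (σ i)))
    simpa using this.symm
  -- In the first row `i` moved by `σ`, the permuted monomial uses column `c (σ.symm i)`, to the
  -- right of `c i`. The two exponents therefore first differ at `(i, c i)`.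
  obtain ⟨i, hi, hmin⟩ : ∃ i, σ.symm i ≠ i ∧ ∀ l < i, σ.symm l = l := by
    refine ⟨Finset.min' _ hne, (Finset.mem_filter.1 (Finset.min'_mem _ hne)).2, fun l hl => ?_⟩
    by_contra hcon
    exact absurd (Finset.min'_le _ l (Finset.mem_filter.2 ⟨Finset.mem_univ _, hcon⟩))
      (not_le.2 hl)
  have hlt : i < σ.symm i := by
    refine lt_of_le_of_ne (not_lt.1 fun h => hi ?_) (Ne.symm hi)
    exact σ.symm.injective (hmin _ h)
  rw [Finsupp.Lex.lt_iff]
  refine ⟨toLex (i, c i), fun p hp => ?_, ?_⟩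
  · obtain ⟨⟨i', j'⟩, rfl⟩ := toLex.surjective p
    simp only [ofLex_toLex]
    rw [sum_single_apply, diagExponent_apply]
    rcases Prod.Lex.lt_iff.1 hp with h | ⟨h, h'⟩
    · rw [hmin i' h]
    · simp only [ofLex_toLex] at h h'
      subst h
      rw [if_neg h'.ne', if_neg (h'.trans (hc hlt)).ne']
  · simp only [ofLex_toLex]
    rw [sum_single_apply, diagExponent_apply, if_pos rfl, if_neg (hc hlt).ne']
    exact one_pos

theorem MonomialOrder.degree_eq_and_monic {σ k : Type*} [CommRing k] [Nontrivial k]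
    (ord : MonomialOrder σ) {f : MvPolynomial σ k} {d : σ →₀ ℕ} (h1 : f.coeff d = 1)
    (h : ∀ b ∈ f.support, b ≼[ord] d) : ord.degree f = d ∧ ord.Monic f := by
  have hd : ord.degree f = d := by
    apply ord.toSyn.injective
    refine le_antisymm (ord.degree_le_iff.2 h) (ord.le_degree ?_)
    rw [MvPolynomial.mem_support_iff, h1]
    exact one_ne_zero
  refine ⟨hd, ?_⟩
  rw [MonomialOrder.Monic, MonomialOrder.leadingCoeff, hd, h1]

/-- The matrix of variables in which the entries marked by `Z` are replaced by zero. -/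
noncomputable def sparseGeneric (k : Type*) [CommRing k] (Z : Fin m → Fin N → Prop)
    [∀ i j, Decidable (Z i j)] : Matrix (Fin m) (Fin N) (MvPolynomial (Fin m ×ₗ Fin N) k) :=
  Matrix.of fun i j =>
    MvPolynomial.monomial (Finsupp.single (toLex (i, j)) 1) (if Z i j then 0 else 1)

theorem MvPolynomial.prod_monomial_eq {σ ι k : Type*} [CommRing k] (s : Finset ι)
    (d : ι → σ →₀ ℕ) (r : ι → k) :
    ∏ i ∈ s, MvPolynomial.monomial (d i) (r i) =
      MvPolynomial.monomial (∑ i ∈ s, d i) (∏ i ∈ s, r i) := by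
  classical
  induction s using Finset.induction_on with
  | empty => simp
  | insert i s hi ih => simp [Finset.prod_insert hi, Finset.sum_insert hi, ih]

variable {k : Type*} [Field k] (Z : Fin m → Fin N → Prop) [∀ i j, Decidable (Z i j)]

/-- The zeros avoid the diagonal, so they can only delete terms lexicographically below the diagonal
monomial. -/
theorem maxMinor_sparseGeneric_degree {c : Fin m → Fin N} (hc : StrictMono c)
    (hZ : ∀ i, ¬ Z i (c i)) :
    lex.degree (maxMinor (sparseGeneric k Z) c) = diagExponent c ∧
      lex.Monic (maxMinor (sparseGeneric k Z) c) := by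
  classical
  have hexp : maxMinor (sparseGeneric k Z) c = ∑ σ : Equiv.Perm (Fin m),
      Equiv.Perm.sign σ • MvPolynomial.monomial (∑ i, Finsupp.single (toLex (σ i, c i)) 1)
        (∏ i, if Z (σ i) (c i) then (0 : k) else 1) := by
    rw [maxMinor, Matrix.det_apply]
    refine Finset.sum_congr rfl fun σ _ => ?_
    rw [← MvPolynomial.prod_monomial_eq]
    rfl
  apply MonomialOrder.degree_eq_and_monic
  · rw [hexp, MvPolynomial.coeff_sum, Finset.sum_eq_single 1]
    · simp [diagExponent, hZ]
    · intro σ _ hσ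
      have hne : (∑ i, Finsupp.single (toLex (σ i, c i)) 1 : Fin m ×ₗ Fin N →₀ ℕ) ≠
          diagExponent c := fun h => (sum_single_lt_diagExponent hc hσ).ne (congrArg toLex h)
      rw [Units.smul_def, zsmul_eq_mul, ← map_intCast (MvPolynomial.C (R := k)), MvPolynomial.coeff_C_mul,
        MvPolynomial.coeff_monomial, if_neg hne, mul_zero]
    · simp
  · intro b hb
    rw [hexp] at hb
    obtain ⟨σ, -, hσ⟩ := Finset.mem_biUnion.1 (MvPolynomial.support_sum hb)
    have hbσ : b = ∑ i, Finsupp.single (toLex (σ i, c i)) 1 := by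
      by_contra hne
      rw [MvPolynomial.mem_support_iff, Units.smul_def, zsmul_eq_mul,
        ← map_intCast (MvPolynomial.C (R := k)), MvPolynomial.coeff_C_mul, MvPolynomial.coeff_monomial,
        if_neg (Ne.symm hne), mul_zero] at hσ
      exact hσ rfl
    rw [hbσ, lex_le_iff]
    by_cases h1 : σ = 1
    · subst h1
      exact le_rfl
    · exact (sum_single_lt_diagExponent hc h1).le

/-- The sum of the diagonal exponents of the entries of `l`. -/
noncomputable def diagExponentSum (l : List (Fin m ↪o Fin N)) : Fin m ×ₗ Fin N →₀ ℕ :=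
  (l.map fun c : Fin m ↪o Fin N => diagExponent c).sum

theorem diagExponentSum_cons (c : Fin m ↪o Fin N) (l : List (Fin m ↪o Fin N)) :
    diagExponentSum (c :: l) = diagExponent c + diagExponentSum l := by
  simp [diagExponentSum]

theorem minorProd_sparseGeneric_degree {l : List (Fin m ↪o Fin N)}
    (hZ : ∀ c ∈ l, ∀ i, ¬ Z i (c i)) :
    lex.degree (minorProd (sparseGeneric k Z) l) = diagExponentSum l ∧
      lex.Monic (minorProd (sparseGeneric k Z) l) := by
  induction l with
  | nil => exact ⟨by simp [minorProd, diagExponentSum], by simp [minorProd]⟩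
  | cons c l ih =>
    obtain ⟨h1, h2⟩ := ih fun d hd => hZ d (List.mem_cons_of_mem c hd)
    obtain ⟨h3, h4⟩ := maxMinor_sparseGeneric_degree (k := k) Z c.strictMono
      (hZ c List.mem_cons_self)
    rw [minorProd_cons]
    refine ⟨?_, h4.mul h2⟩
    rw [degree_mul h4.ne_zero h2.ne_zero, h1, h3, diagExponentSum_cons]

theorem diagExponentSum_apply (l : List (Fin m ↪o Fin N)) (i : Fin m) (j : Fin N) :
    diagExponentSum l (toLex (i, j)) = (l.map fun c => c i).count j := by
  induction l with
  | nil => simp [diagExponentSum]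
  | cons c l ih =>
    rw [diagExponentSum_cons, Finsupp.add_apply, ih, diagExponent_apply, List.map_cons,
      List.count_cons, add_comm]
    simp

/-- A standard list is determined by its length and the sum of its diagonal exponents. -/
theorem IsStandard.eq_of_sum_diagExponent_eq {l l' : List (Fin m ↪o Fin N)} (hl : IsStandard l)
    (hl' : IsStandard l') (hlen : l.length = l'.length)
    (h : diagExponentSum l = diagExponentSum l') :
    l = l' := by
  have hi : ∀ i : Fin m, (l.map fun c => c i) = l'.map fun c => c i := by
    intro i
    -- Standardness makes the list of `i`-th columns sorted, and the exponents give its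
    -- multiplicities.
    refine List.Perm.eq_of_pairwise (le := (· ≤ ·)) (fun a b _ _ h h' => le_antisymm h h')
      (List.pairwise_map.2 (hl.imp fun h => h i)) (List.pairwise_map.2 (hl'.imp fun h => h i)) ?_
    rw [List.perm_iff_count]
    intro j
    rw [← diagExponentSum_apply, ← diagExponentSum_apply, h]
  refine List.ext_getElem hlen fun q h1 h2 => ?_
  ext i
  have := congrArg (fun l => (l[q]?)) (hi i)
  simp [h1, h2] at this
  simp [this]

/-- Standard products of nonvanishing minors are linearly independent. -/
theorem eq_zero_of_sum_minorProd_sparseGeneric {K : ℕ} (w : List (Fin m ↪o Fin N) →₀ k)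
    (hw : ∀ l ∈ w.support, IsStandard l ∧ l.length = K ∧ ∀ c ∈ l, ∀ i, ¬ Z i (c i))
    (h : w.sum (fun l a => a • minorProd (sparseGeneric k Z) l) = 0) : w = 0 := by
  by_contra hne
  -- The largest leading monomial belongs to only one standard list of length `K`, so it cannot
  -- cancel.
  obtain ⟨l, hl, hmax⟩ := Finset.exists_max_image w.support
    (fun l => lex.toSyn (diagExponentSum l)) (Finsupp.support_nonempty_iff.2 hne)
  have hcoeff := congrArg (MvPolynomial.coeff (diagExponentSum l)) h
  rw [Finsupp.sum, MvPolynomial.coeff_sum, Finset.sum_eq_single l] at hcoeff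
  · obtain ⟨hd, hm⟩ := minorProd_sparseGeneric_degree (k := k) Z (hw l hl).2.2
    rw [MvPolynomial.coeff_smul, ← hd, hm.coeff_degree] at hcoeff
    simp at hcoeff
    exact Finsupp.mem_support_iff.1 hl hcoeff
  · intro l' hl' hne'
    obtain ⟨hd, -⟩ := minorProd_sparseGeneric_degree (k := k) Z (hw l' hl').2.2
    rw [MvPolynomial.coeff_smul, coeff_eq_zero_of_lt (m := lex), smul_zero]
    rw [hd]
    refine lt_of_le_of_ne (hmax l' hl') fun heq => hne' ?_
    exact (hw l' hl').1.eq_of_sum_diagExponent_eq (hw l hl).1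
      ((hw l' hl').2.1.trans (hw l hl).2.1.symm) (lex.toSyn.injective heq)
  · exact fun h => absurd hl h

end LeadingTerm

/-! ### Independence modulo I_r(A) by specialization to low rank. -/

section RankTest

variable {m n : ℕ}

/-- The minors of size `r` vanish on a product factoring through fewer than `r` nonzero rows. -/
theorem det_mul_eq_zero_of_rows_eq_zero {K : Type*} [Field K] {r : ℕ}
    (B : Matrix (Fin r) (Fin m) K) (Y : Matrix (Fin m) (Fin r) K) (hr : 0 < r)
    (hY : ∀ (i : Fin m) (j : Fin r), r ≤ (i : ℕ) + 1 → Y i j = 0) : (B * Y).det = 0 := by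
  -- The rows of `Y` that may be nonzero, padded by zero rows if `m < r - 1`. With fewer rows than
  -- columns, `Y'` has a nonzero kernel vector.
  let Y' : Matrix (Fin (r - 1)) (Fin r) K :=
    Matrix.of fun i j => if h : (i : ℕ) < m then Y ⟨i, h⟩ j else 0
  have hker : LinearMap.ker Y'.mulVecLin ≠ ⊥ := by
    apply LinearMap.ker_ne_bot_of_finrank_lt
    simpa using hr
  obtain ⟨v, hv, hv0⟩ := Submodule.exists_mem_ne_zero_of_ne_bot hker
  refine Matrix.exists_mulVec_eq_zero_iff.1 ⟨v, hv0, ?_⟩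
  suffices hYv : Y.mulVec v = 0 by rw [← Matrix.mulVec_mulVec, hYv, Matrix.mulVec_zero]
  ext i
  by_cases hi : r ≤ (i : ℕ) + 1
  · simp [Matrix.mulVec, dotProduct, hY i _ hi]
  · have := congrFun (LinearMap.mem_ker.1 hv) ⟨i, by omega⟩
    simpa [Matrix.mulVec, dotProduct, Y'] using this

theorem RingHom.map_maxMinor {R S : Type*} [CommRing R] [CommRing S] (φ : R →+* S) {N : ℕ}
    (M : Matrix (Fin m) (Fin N) R) (c : Fin m → Fin N) :
    φ (maxMinor M c) = maxMinor (M.map φ) c := by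
  rw [maxMinor, RingHom.map_det]
  rfl

theorem map_augmentOne {R S : Type*} [CommRing R] [CommRing S] (φ : R →+* S)
    (X : Matrix (Fin m) (Fin n) R) : (augmentOne X).map φ = augmentOne (X.map φ) := by
  ext i j
  induction j using Fin.addCases with
  | left j => simp [augmentOne_castAdd]
  | right j => simp [augmentOne_natAdd, Matrix.one_apply, apply_ite φ]

/-- Normalizing the right block to 1 turns an arbitrary `W` into an augmented matrix, at the cost of
scaling all maximal minors by one determinant. -/
theorem augmentOne_inv_mul {K : Type*} [Field K] (W : Matrix (Fin m) (Fin (n + m)) K)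
    (hW : maxMinor W (Fin.natAdd n) ≠ 0) :
    augmentOne ((W.submatrix id (Fin.natAdd n))⁻¹ * W.submatrix id (Fin.castAdd m)) =
      (W.submatrix id (Fin.natAdd n))⁻¹ * W := by
  ext i j
  induction j using Fin.addCases with
  | left j =>
    rw [augmentOne_castAdd]
    rfl
  | right j =>
    rw [augmentOne_natAdd, ← Matrix.nonsing_inv_mul _ (isUnit_iff_ne_zero.2 hW)]
    rfl

theorem maxMinor_mul {R : Type*} [CommRing R] {N : ℕ} (B : Matrix (Fin m) (Fin m) R)
    (W : Matrix (Fin m) (Fin N) R) (c : Fin m → Fin N) :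
    maxMinor (B * W) c = B.det * maxMinor W c := by
  rw [maxMinor, maxMinor, ← Matrix.det_mul]
  rfl

theorem minorProd_mul {R : Type*} [CommRing R] {N : ℕ} (B : Matrix (Fin m) (Fin m) R)
    (W : Matrix (Fin m) (Fin N) R) (l : List (Fin m ↪o Fin N)) :
    minorProd (B * W) l = B.det ^ l.length * minorProd W l := by
  induction l with
  | nil => simp [minorProd]
  | cons c l ih =>
    rw [minorProd_cons, minorProd_cons, maxMinor_mul, ih, List.length_cons]
    ring

theorem RingHom.map_minorProd {R S : Type*} [CommRing R] [CommRing S] (φ : R →+* S) {N : ℕ}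
    (M : Matrix (Fin m) (Fin N) R) (l : List (Fin m ↪o Fin N)) :
    φ (minorProd M l) = minorProd (M.map φ) l := by
  induction l with
  | nil => simp [minorProd]
  | cons c l ih => rw [minorProd_cons, minorProd_cons, map_mul, ih, RingHom.map_maxMinor]

variable {k : Type*} [Field k]

local notation "Xg" => Matrix.mvPolynomialX (Fin m) (Fin n) k

/-- Standard products with fewer than `r` columns of `A` in the first factor are linearly
independent modulo `I_r(A)`. -/
theorem eq_zero_of_sum_minorProd_mem_minorIdeal {a r K : ℕ} (ha : a ≤ n)
    (w : List (Fin m ↪o Fin (n + m)) →₀ k)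
    (hw : ∀ l ∈ w.support, l.length = K ∧ IsStandard l ∧
      ∃ c l', l = c :: l' ∧ countBelow a c < r)
    (h : w.sum (fun l x => x • minorProd (augmentOne Xg) l) ∈ minorIdeal r (firstColumns a ha Xg)) :
    w = 0 := by
  rcases Nat.eq_zero_or_pos r with rfl | hr
  · rw [← Finsupp.support_eq_empty, Finset.eq_empty_iff_forall_notMem]
    intro l hl
    obtain ⟨-, -, c, l', -, hc⟩ := hw l hl
    omega
  -- With rows numbered from 0, only the first `r - 1` rows may be nonzero in the columns of A, so
  -- that block has rank less than `r`.
  let Z : Fin m → Fin (n + m) → Prop := fun i j => r ≤ (i : ℕ) + 1 ∧ (j : ℕ) < a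
  have hZdec : ∀ i j, Decidable (Z i j) := fun i j => inferInstanceAs (Decidable (_ ∧ _))
  let P := MvPolynomial (Fin m ×ₗ Fin (n + m)) k
  let F := FractionRing P
  let W : Matrix (Fin m) (Fin (n + m)) F := (sparseGeneric k Z).map (algebraMap P F)
  let L := W.submatrix id (Fin.natAdd n)
  have hW : maxMinor W (Fin.natAdd n) ≠ 0 := by
    have hne := (maxMinor_sparseGeneric_degree (k := k) Z
      (c := Fin.natAdd n) (fun _ _ h => Fin.natAddOrderEmb n |>.strictMono h) (by
        intro i hi
        have := hi.2
        simp at this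
        omega)).2.ne_zero
    rw [← RingHom.map_maxMinor]
    exact (map_ne_zero_iff _ (IsFractionRing.injective P F)).2 hne
  have hL : L⁻¹.det ≠ 0 := by
    rw [Matrix.det_nonsing_inv, Ring.inverse_eq_inv']
    exact inv_ne_zero hW
  let Y := W.submatrix id (Fin.castAdd m)
  -- Sends (X | 1) to `L⁻¹ * W`. Products of `K` maximal minors thus all acquire the same nonzero
  -- factor `L⁻¹.det ^ K`.
  let φ : MvPolynomial (Fin m × Fin n) k →ₐ[k] F :=
    MvPolynomial.aeval fun ij => (L⁻¹ * Y) ij.1 ij.2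
  have hφX : Matrix.map Xg (φ : MvPolynomial (Fin m × Fin n) k →+* F) = L⁻¹ * Y := by
    ext i j
    simp [φ]
  have hφ : ∀ l, φ (minorProd (augmentOne Xg) l) =
      L⁻¹.det ^ l.length * algebraMap P F (minorProd (sparseGeneric k Z) l) := by
    intro l
    change (φ : MvPolynomial (Fin m × Fin n) k →+* F) _ = _
    rw [RingHom.map_minorProd, map_augmentOne, hφX, augmentOne_inv_mul W hW, minorProd_mul,
      RingHom.map_minorProd]
  have hkill : minorIdeal r (firstColumns a ha Xg) ≤
      RingHom.ker (φ : MvPolynomial (Fin m × Fin n) k →+* F) := by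
    refine Ideal.span_le.2 ?_
    rintro _ ⟨rows, cols, rfl⟩
    rw [SetLike.mem_coe, RingHom.mem_ker, RingHom.map_det]
    have hfac : (φ : MvPolynomial (Fin m × Fin n) k →+* F).mapMatrix
        ((firstColumns a ha Xg).submatrix rows cols) =
        L⁻¹.submatrix rows id * Y.submatrix id (fun j => Fin.castLE ha (cols j)) := by
      change (Matrix.map Xg (φ : MvPolynomial (Fin m × Fin n) k →+* F)).submatrix rows
        (fun j => Fin.castLE ha (cols j)) = _
      rw [hφX]
      rfl
    rw [hfac]
    refine det_mul_eq_zero_of_rows_eq_zero _ _ hr fun (i : Fin m) j hi => ?_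
    have hz : Z i (Fin.castAdd m (Fin.castLE ha (cols j))) := ⟨hi, (cols j).2⟩
    simp [Y, W, sparseGeneric, hz]
  apply eq_zero_of_sum_minorProd_sparseGeneric Z (K := K) w
  -- A zero at `(i, d i)` would give `c i ≤ d i < a`, hence `i < countBelow a c ≤ r - 1`, against `r
  -- ≤ i + 1`. By standardness, the bound on the first factor thus protects the diagonals of all
  -- factors.
  · intro l hl
    obtain ⟨hlen, hstd, c, l', rfl, hc⟩ := hw l hl
    refine ⟨hstd, hlen, fun d hd i hi => ?_⟩
    have hcd : c i ≤ d i := by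
      rcases List.mem_cons.1 hd with rfl | hd
      · exact le_rfl
      · exact (List.pairwise_cons.1 hstd).1 d hd i
    have := (lt_countBelow_iff c i).2 (lt_of_le_of_lt hcd hi.2)
    have := hi.1
    omega
  · have hzero : φ (w.sum fun l x => x • minorProd (augmentOne Xg) l) = 0 := hkill h
    have : L⁻¹.det ^ K * algebraMap P F (w.sum fun l x => x • minorProd (sparseGeneric k Z) l) =
        0 := by
      rw [← hzero, Finsupp.sum, Finsupp.sum, map_sum, map_sum, Finset.mul_sum]
      refine Finset.sum_congr rfl fun l hl => ?_
      rw [map_smul φ, hφ, (hw l hl).1, ← IsScalarTower.coe_toAlgHom' k P F, map_smul,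
        mul_smul_comm]
    rcases mul_eq_zero.1 this with h0 | h0
    · exact absurd h0 (pow_ne_zero _ hL)
    · exact (map_eq_zero_iff _ (IsFractionRing.injective P F)).1 h0

end RankTest

/-! ### The intersection formula. -/

theorem mainTheorem2 {k : Type*} [Field k] (m n a t r : ℕ) (ha : a ≤ n) (hrt : r ≤ t) :
    blockMinorIdeal a t r (Matrix.mvPolynomialX (Fin m) (Fin n) k) =
      minorIdeal t (Matrix.mvPolynomialX (Fin m) (Fin n) k) ⊓
        minorIdeal r (firstColumns a ha (Matrix.mvPolynomialX (Fin m) (Fin n) k)) := by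
  set X := Matrix.mvPolynomialX (Fin m) (Fin n) k
  refine le_antisymm (le_inf (blockMinorIdeal_le_minorIdeal a t r X)
    (blockMinorIdeal_le_minorIdeal_firstColumns ha hrt X)) ?_
  rintro f ⟨hft, hfr⟩
  obtain ⟨K, hK⟩ := exists_mem_standardSpan_of_mem_minorIdeal hft
  let S : Set (List (Fin m ↪o Fin (n + m))) := {l | l.length = K + 1 ∧ IsStandard l ∧
      ∃ c l', l = c :: l' ∧ countBelow a c < r}
  have hsplit : standardSpan k (augmentOne X) n t K ≤
      (blockMinorIdeal a t r X).restrictScalars k ⊔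
        Submodule.span k (minorProd (augmentOne X) '' S) := by
    refine Submodule.span_le.2 ?_
    rintro _ ⟨c, l, hl, hlen, hc, rfl⟩
    by_cases hr : r ≤ countBelow a c
    · refine Submodule.mem_sup_left ?_
      rw [minorProd_cons]
      exact Ideal.mul_mem_right _ _ (maxMinor_augmentOne_mem_blockMinorIdeal hrt X c hc hr)
    · exact Submodule.mem_sup_right (Submodule.subset_span
        ⟨c :: l, ⟨by simp [hlen], hl, c, l, rfl, not_le.1 hr⟩, rfl⟩)
  obtain ⟨g, hg, h, hh, rfl⟩ := Submodule.mem_sup.1 (hsplit hK)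
  obtain ⟨w, hwS, rfl⟩ := (Finsupp.mem_span_image_iff_linearCombination k).1 hh
  -- Both `f` and its part `g` in J lie in I_r(A), hence so does the combination of the remaining
  -- standard products.
  have hhr : w.sum (fun l x => x • minorProd (augmentOne X) l) ∈
      minorIdeal r (firstColumns a ha X) := by
    have := sub_mem hfr (blockMinorIdeal_le_minorIdeal_firstColumns ha hrt X hg)
    rwa [add_sub_cancel_left] at this
  have hw0 : w = 0 := eq_zero_of_sum_minorProd_mem_minorIdeal ha w
    (fun l hl => (Finsupp.mem_supported k w).1 hwS hl) hhr
  rw [hw0, map_zero, add_zero]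
  exact hg
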